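/- Let $n\ge 2$ and let $\Sigma_n$ be a disk with $n+1$ marked points $v_0,\dots,v_n$ on its boundary (in counterclockwise order), no punctures, and one orbifold point of order three in its interior. An arc is a curve joining marked points that has no self-intersections (its endpoints may coincide), meets the marked points only in its endpoints, avoids the orbifold point, is not isotopic to a boundary segment, and, if it cuts out a monogon, this monogon contains the orbifold point (then the arc is called pending); arcs are taken up to isotopy fixing the marked points and the orbifold point, and up to orientation. Two arcs are compatible if they have representatives that do not meet outside the marked points. A triangulation $\tau$ of $\Sigma_n$ is a maximal set of pairwise compatible arcs; it contains exactly one pending arc. The triangles of $\tau$ are the closures of the components of the complement in $\Sigma_n$ of the non-pending arcs of $\tau$; the component containing the orbifold point gives the orbifold triangle, a digon whose three sides are its two boundary sides and the pending arc inside it. A triangle is internal if none of its sides is a boundary segment. Let $Q(\tau)$ be the quiver whose vertices are the arcs of $\tau$, with an arrow $j\to i$ for each triangle $\Delta$ of $\tau$ and each pair of arcs $i,j$ that are sides of $\Delta$ such that $i$ directly succeeds $j$ in the clockwise orientation of $\Delta$, and with one further loop $\varepsilon$ at the pending arc. Let $S(\tau)=\sum_{\Delta} c_\Delta b_\Delta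 a_\Delta+\varepsilon^3$, where $\Delta$ runs over the internal triangles of $\tau$ and $c_\Delta b_\Delta a_\Delta$ is the 3-cycle of $Q(\tau)$ formed by the three arrows of $\Delta$. Let $\Lambda(\tau)=\mathcal P(Q(\tau),S(\tau))=\mathbb C\langle\langle Q(\tau)\rangle\rangle/J(Q(\tau),S(\tau))$ be the Jacobian algebra, where $\mathbb C\langle\langle Q\rangle\rangle$ is the completed path algebra and $J(Q,S)$ is the closure, in the topology given by the powers of the arrow ideal, of the two-sided ideal generated by all cyclic derivatives $\partial_a S$, $a\in Q_1$. Then $\Lambda(\tau)$ is a gentle algebra. That is, there is a set $P$ of paths of length two in $Q=Q(\tau)$ such that the inclusion $\mathbb C\langle Q\rangle\subseteq\mathbb C\langle\langle Q\rangle\rangle$ of the path algebra induces an isomorphism of $\mathbb C$-algebras $\mathbb C\langle Q\rangle/\langle P\rangle\cong\Lambda(\tau)$, and: (1) at every vertex of $Q$ at most two arrows start and at most two arrows end; (2) for every arrow $a$ there is at most one arrow $b$ such that $ab$ is a path not in $P$, and at most one arrow $c$ such that $ca$ is a path not in $P$; (3) the ideal $\langle P\rangle$ of $\mathbb C\langle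 Q\rangle$ is admissible, i.e. it is contained in the square of the arrow ideal and contains some power of the arrow ideal; (4) for every arrow $a$ there is at most one arrow $b$ such that $ab$ is a path in $P$, and at most one arrow $c$ such that $ca$ is a path in $P$. -/

import Mathlib

/-! ## Paths, the completed path algebra and the path algebra of a quiver

Quivers are Mathlib's: for `e : i ⟶ j` the tail of `e` is `i` and its head is `j`.
`Quiver.Path i j` is the type of paths that start at `i` and end at `j`. -/

namespace OrbPoly

open Quiver

/-- All paths of a quiver (including the trivial path at each vertex). -/
abbrev QPath (V : Type*) [Quiver V] := Σ i j : V, Path i j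

/-- The length of a path. -/
def QPath.len {V : Type*} [Quiver V] (p : QPath V) : ℕ := p.2.2.length

/-- All ways of cutting a path `p` into an initial part `q` and a final part `r`,
so that `p = q.comp r`; a path of length `m` has `m + 1` of them. -/
def splits {V : Type*} [Quiver V] {i : V} :
    {j : V} → Path i j → List (Σ k : V, Path i k × Path k j)
  | _, .nil => [⟨i, .nil, .nil⟩]
  | _, .cons p e =>
      ⟨_, .cons p e, .nil⟩ :: (splits p).map fun s => ⟨s.1, s.2.1, s.2.2.cons e⟩

/-- The completed path algebra `ℂ⟨⟨Q⟩⟩` of a quiver `Q` with finitely many vertices and arrows: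
a possibly infinite linear combination of paths is the family of its coefficients. -/
def CompletedPathAlgebra (V : Type*) [Quiver V] : Type _ := QPath V → ℂ

namespace CompletedPathAlgebra

variable {V : Type*} [Quiver V]

noncomputable instance : AddCommGroup (CompletedPathAlgebra V) :=
  inferInstanceAs (AddCommGroup (QPath V → ℂ))

noncomputable instance : Module ℂ (CompletedPathAlgebra V) :=
  inferInstanceAs (Module ℂ (QPath V → ℂ))

/-- The sum of the trivial paths. -/
noncomputable instance : One (CompletedPathAlgebra V) :=
  ⟨fun p => if p.len = 0 then 1 else 0⟩

/-- The product extends concatenation of paths. Paths are composed like maps: in `f * g` the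
factor `g` contributes the initial part of a path and `f` the final part. -/
noncomputable instance : Mul (CompletedPathAlgebra V) :=
  ⟨fun f g p => ((splits p.2.2).map fun s => f ⟨_, _, s.2.2⟩ * g ⟨_, _, s.2.1⟩).sum⟩

/-- The path `p` as an element of the completed path algebra. -/
noncomputable def ofPath (p : QPath V) : CompletedPathAlgebra V :=
  fun q => by classical exact if q = p then 1 else 0

@[ext]
theorem ext {f g : CompletedPathAlgebra V} (h : ∀ p, f p = g p) : f = g := funext h

@[simp] theorem add_apply (f g : CompletedPathAlgebra V) (p : QPath V) :
    (f + g) p = f p + g p := rfl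

@[simp] theorem neg_apply (f : CompletedPathAlgebra V) (p : QPath V) : (-f) p = -f p := rfl

@[simp] theorem zero_apply (p : QPath V) : (0 : CompletedPathAlgebra V) p = 0 := rfl

@[simp] theorem smul_apply (c : ℂ) (f : CompletedPathAlgebra V) (p : QPath V) :
    (c • f) p = c * f p := rfl

theorem one_apply (p : QPath V) :
    (1 : CompletedPathAlgebra V) p = if p.len = 0 then 1 else 0 := rfl

theorem mul_apply (f g : CompletedPathAlgebra V) (p : QPath V) :
    (f * g) p = ((splits p.2.2).map fun s => f ⟨_, _, s.2.2⟩ * g ⟨_, _, s.2.1⟩).sum := rfl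

end CompletedPathAlgebra

section splits

variable {V : Type*} [Quiver V]

theorem splits_comp {i j : V} (p : Path i j) : ∀ s ∈ splits p, s.2.1.comp s.2.2 = p := by
  induction p with
  | nil => simp [splits]
  | cons p e ih =>
    intro s hs
    simp only [splits, List.mem_cons, List.mem_map] at hs
    rcases hs with rfl | ⟨t, ht, rfl⟩
    · rfl
    · simp [ih t ht]

theorem splits_assoc {i j : V} (p : Path i j)
    (F : ∀ k l : V, Path i k → Path k l → Path l j → ℂ) :
    ((splits p).map fun s =>
      ((splits s.2.1).map fun t => F _ _ t.2.1 t.2.2 s.2.2).sum).sum =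
    ((splits p).map fun s =>
      ((splits s.2.2).map fun t => F _ _ s.2.1 t.2.1 t.2.2).sum).sum := by
  induction p with
  | nil => simp [splits]
  | cons p e ih =>
    have := ih fun k l a b c => F k l a b (c.cons e)
    simp only [splits, List.map_cons, List.map_map, List.sum_cons, Function.comp_def,
      List.sum_map_add, List.map_nil, List.sum_nil] at this ⊢
    rw [this]
    ring

end splits

namespace CompletedPathAlgebra

variable {V : Type*} [Quiver V]

theorem one_mul_aux {i j : V} (p : Path i j) (g : ∀ k : V, Path i k → ℂ) :
    ((splits p).map fun s => (if s.2.2.length = 0 then (1 : ℂ) else 0) * g _ s.2.1).sum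
      = g _ p := by
  cases p with
  | nil => simp [splits]
  | cons p e => simp [splits, Function.comp_def]

theorem mul_one_aux {i j : V} (p : Path i j) (g : ∀ k : V, Path k j → ℂ) :
    ((splits p).map fun s => g _ s.2.2 * (if s.2.1.length = 0 then (1 : ℂ) else 0)).sum
      = g _ p := by
  induction p with
  | nil => simp [splits]
  | cons p e ih => simpa [splits, Function.comp_def] using ih fun k r => g k (r.cons e)

noncomputable instance : Ring (CompletedPathAlgebra V) :=
  { (inferInstance : AddCommGroup (CompletedPathAlgebra V)),
    (inferInstance : One (CompletedPathAlgebra V)),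
    (inferInstance : Mul (CompletedPathAlgebra V)) with
    left_distrib := fun f g h => by
      ext p; simp [mul_apply, mul_add, List.sum_map_add]
    right_distrib := fun f g h => by
      ext p; simp [mul_apply, add_mul, List.sum_map_add]
    zero_mul := fun f => by ext p; simp [mul_apply]
    mul_zero := fun f => by ext p; simp [mul_apply]
    mul_assoc := fun f g h => by
      ext p
      have := splits_assoc p.2.2 fun k l a b c => f ⟨_, _, c⟩ * (g ⟨_, _, b⟩ * h ⟨_, _, a⟩)
      simp only [mul_apply, ← List.sum_map_mul_left, ← List.sum_map_mul_right, mul_assoc]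
      exact this.symm
    one_mul := fun f => by
      ext p
      exact one_mul_aux p.2.2 fun k q => f ⟨_, k, q⟩
    mul_one := fun f => by
      ext p
      exact mul_one_aux p.2.2 fun k q => f ⟨k, _, q⟩ }

noncomputable instance : Algebra ℂ (CompletedPathAlgebra V) :=
  Algebra.ofModule
    (fun c f g => by
      ext p; simp [mul_apply, mul_assoc, List.sum_map_mul_left])
    (fun c f g => by
      ext p; simp [mul_apply, mul_left_comm _ c, List.sum_map_mul_left])

/-- The `m`-th power `𝔐^m` of the ideal `𝔐` generated by the arrows: the combinations of
paths of length at least `m`. -/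
noncomputable def arrowIdealPow (V : Type*) [Quiver V] (m : ℕ) : TwoSidedIdeal (CompletedPathAlgebra V) :=
  TwoSidedIdeal.mk' {f | ∀ p : QPath V, p.len < m → f p = 0}
    (fun _ _ => rfl)
    (fun hx hy p hp => by simp [hx p hp, hy p hp])
    (fun hx p hp => by simp [hx p hp])
    (fun {x y} hy p hp => by
      rw [mul_apply]
      refine List.sum_eq_zero fun c hc => ?_
      obtain ⟨s, hs, rfl⟩ := List.mem_map.1 hc
      have h := congrArg Path.length (splits_comp _ s hs)
      rw [Path.length_comp] at h
      rw [hy ⟨_, _, s.2.1⟩ (by unfold QPath.len at hp ⊢; dsimp only; omega), mul_zero])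
    (fun {x y} hx p hp => by
      rw [mul_apply]
      refine List.sum_eq_zero fun c hc => ?_
      obtain ⟨s, hs, rfl⟩ := List.mem_map.1 hc
      have h := congrArg Path.length (splits_comp _ s hs)
      rw [Path.length_comp] at h
      rw [hx ⟨_, _, s.2.2⟩ (by unfold QPath.len at hp ⊢; dsimp only; omega), zero_mul])

/-- The closure `⋂ₘ (I + 𝔐^m)` of an ideal in the `𝔐`-adic topology. -/
noncomputable def closure (I : TwoSidedIdeal (CompletedPathAlgebra V)) :
    TwoSidedIdeal (CompletedPathAlgebra V) :=
  ⨅ m : ℕ, I ⊔ arrowIdealPow V m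

/-- The cyclic derivative of a potential `S` with respect to an arrow `a`. On a cycle it is
`∂ₐ(aₙ ⋯ a₁) = ∑ₖ δ_{a,aₖ} aₖ₋₁ ⋯ a₁ aₙ ⋯ aₖ₊₁`. Hence the coefficient of a path `p` in `∂ₐ S` is
the sum, over all ways of writing `p` as `u` followed by `v` with `u` starting at the head
and `v` ending at the tail of `a`, of the coefficient in `S` of the cycle that runs through `v`,
then `a`, then `u`. -/
noncomputable def cyclicDerivative {i j : V} (a : i ⟶ j) (S : CompletedPathAlgebra V) :
    CompletedPathAlgebra V := fun p => by
  classical exact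
    if h : p.1 = j ∧ p.2.1 = i then
      ((splits (p.2.2.cast h.1 h.2)).map fun s => S ⟨_, _, (s.2.2.cons a).comp s.2.1⟩).sum
    else 0

/-- The Jacobian ideal: the closure of the two-sided ideal generated by all cyclic
derivatives of the potential. -/
noncomputable def jacobianIdeal (S : CompletedPathAlgebra V) :
    TwoSidedIdeal (CompletedPathAlgebra V) :=
  closure (TwoSidedIdeal.span {f | ∃ (i j : V) (a : i ⟶ j), f = cyclicDerivative a S})

/-- The Jacobian algebra `𝒫(Q, S) = ℂ⟨⟨Q⟩⟩ / J(Q, S)`. -/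
abbrev JacobianAlgebra (S : CompletedPathAlgebra V) : Type _ := (jacobianIdeal S).ringCon.Quotient

end CompletedPathAlgebra

open CompletedPathAlgebra

/-- The path algebra `ℂ⟨Q⟩`: the finite linear combinations of paths. -/
noncomputable def PathAlgebra (V : Type*) [Quiver V] [Finite V] :
    Subalgebra ℂ (CompletedPathAlgebra V) where
  carrier := {f | {p : QPath V | f p ≠ 0}.Finite}
  mul_mem' := by
    intro f g hf hg
    refine Set.Finite.subset (hf.image2 (fun (a b : QPath V) => by
      classical exact if h : b.2.1 = a.1 then
        (⟨b.1, a.2.1, (b.2.2.cast rfl h).comp a.2.2⟩ : QPath V) else a) hg) ?_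
    rintro ⟨i, j, p⟩ hp
    rw [Set.mem_ofPred_eq, mul_apply] at hp
    obtain ⟨c, hc, hc0⟩ : ∃ c ∈ (splits p).map fun s =>
        f ⟨_, _, s.2.2⟩ * g ⟨_, _, s.2.1⟩, c ≠ 0 := by
      by_contra hcon
      push Not at hcon
      exact hp (List.sum_eq_zero hcon)
    obtain ⟨s, hs, rfl⟩ := List.mem_map.1 hc
    refine ⟨⟨_, _, s.2.2⟩, left_ne_zero_of_mul hc0, ⟨_, _, s.2.1⟩, right_ne_zero_of_mul hc0, ?_⟩
    simp [splits_comp p s hs]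
  add_mem' := by
    intro f g hf hg
    refine (hf.union hg).subset fun p hp => ?_
    by_contra hcon
    simp only [Set.mem_union, Set.mem_ofPred_eq, not_or, not_not] at hcon
    exact hp (by simp [hcon.1, hcon.2])
  algebraMap_mem' := by
    intro c
    refine (Set.finite_range fun i : V => (⟨i, i, .nil⟩ : QPath V)).subset ?_
    rintro ⟨i, j, p⟩ hp
    rw [Algebra.algebraMap_eq_smul_one, Set.mem_ofPred_eq, CompletedPathAlgebra.smul_apply, one_apply] at hp
    cases p with
    | nil => exact ⟨i, rfl⟩
    | cons p e => simp [QPath.len] at hp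

/-- The two-sided ideal `⟨P⟩` of the path algebra generated by a set `P` of paths. -/
noncomputable def pathIdeal {V : Type*} [Quiver V] [Finite V] (P : Set (QPath V)) :
    TwoSidedIdeal (PathAlgebra V) :=
  TwoSidedIdeal.span {x | ∃ p ∈ P, (x : CompletedPathAlgebra V) = ofPath p}

/-- The path `b a`: first the arrow `a`, then the arrow `b`. -/
def path₂ {V : Type*} [Quiver V] {i j k : V} (b : j ⟶ k) (a : i ⟶ j) : QPath V :=
  ⟨i, k, a.toPath.comp b.toPath⟩

/-- `ℂ⟨Q⟩ / ⟨P⟩` is a string algebra. -/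
structure IsString {V : Type*} [Quiver V] [Finite V] (P : Set (QPath V)) : Prop where
  /-- at most two arrows start at any vertex -/
  tail_le : ∀ i : V, ENat.card (Σ j : V, i ⟶ j) ≤ 2
  /-- at most two arrows end at any vertex -/
  head_le : ∀ i : V, ENat.card (Σ j : V, j ⟶ i) ≤ 2
  /-- for any arrow `a` there is at most one arrow `b` such that `a b` is a path not in `P` -/
  before_le : ∀ (i j : V) (a : i ⟶ j), {b : Σ k : V, k ⟶ i | path₂ a b.2 ∉ P}.encard ≤ 1
  /-- for any arrow `a` there is at most one arrow `c` such that `c a` is a path not in `P` -/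
  after_le : ∀ (i j : V) (a : i ⟶ j), {c : Σ k : V, j ⟶ k | path₂ c.2 a ∉ P}.encard ≤ 1
  /-- `⟨P⟩` is admissible: it lies in the square of the arrow ideal ... -/
  le_sq : ∀ x ∈ pathIdeal P, ∀ p : QPath V, p.len < 2 → (x : CompletedPathAlgebra V) p = 0
  /-- ... and contains some power of the arrow ideal -/
  pow_le : ∃ m : ℕ, ∀ x : PathAlgebra V,
    (∀ p : QPath V, p.len < m → (x : CompletedPathAlgebra V) p = 0) → x ∈ pathIdeal P

/-- `ℂ⟨Q⟩ / ⟨P⟩` is a gentle algebra. -/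
structure IsGentle {V : Type*} [Quiver V] [Finite V] (P : Set (QPath V)) : Prop
    extends IsString P where
  /-- the relations are paths of length two -/
  len_eq : ∀ p ∈ P, p.len = 2
  /-- for any arrow `a` there is at most one arrow `b` such that `a b` is a path in `P` -/
  before_mem_le : ∀ (i j : V) (a : i ⟶ j), {b : Σ k : V, k ⟶ i | path₂ a b.2 ∈ P}.encard ≤ 1
  /-- for any arrow `a` there is at most one arrow `c` such that `c a` is a path in `P` -/
  after_mem_le : ∀ (i j : V) (a : i ⟶ j), {c : Σ k : V, j ⟶ k | path₂ c.2 a ∈ P}.encard ≤ 1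

/-! ## The polygon with one orbifold point

`Σ_n` is a disk with `n + 1` marked points `v_0, …, v_n` on its boundary, in counterclockwise
order, and one orbifold point in its interior. Isotopies fix the orbifold point and arcs avoid it,
so arcs live in the annulus obtained by removing it. The universal cover of this annulus
is a half plane `ℝ × [0, ∞)`; the marked points lift to the integers on its boundary line, `a : ℤ`
lying over `v_{a mod n+1}`, the counterclockwise direction on the boundary of the disk being the
increasing one, and the deck transformations are the translations by multiples of `n + 1`.
A curve between marked points is determined up to homotopy by the two endpoints of a lift of it.
So a class of non-contractible unoriented curves is a pair `a < b` of integers up to simultaneous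
translation by multiples of `n + 1`. Two lifts have to cross if and only if their endpoints
interlace on the boundary line, and representatives (for instance geodesics) can be chosen that
have no crossings except those. -/

/-- The endpoints of two curves in the half plane interlace on its boundary line. -/
def Interlace (p q : ℤ × ℤ) : Prop :=
  (p.1 < q.1 ∧ q.1 < p.2 ∧ p.2 < q.2) ∨ (q.1 < p.1 ∧ p.1 < q.2 ∧ q.2 < p.2)

/-- The deck transformation: translation by `k (n + 1)`. -/
def translate (n : ℕ) (k : ℤ) (p : ℤ × ℤ) : ℤ × ℤ := (p.1 + k * (n + 1), p.2 + k * (n + 1))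

/-- An isotopy class of arcs of `Σ_n`, given by the endpoints `a < b` of its unique lift with
`0 ≤ a ≤ n`. It runs from `v_a` to `v_b` (indices mod `n + 1`) and is homotopic, in the complement
of the orbifold point, to the counterclockwise boundary path made of `b - a` boundary segments. -/
@[ext]
structure Arc (n : ℕ) where
  a : ℤ
  b : ℤ
  a_nonneg : 0 ≤ a
  a_le : a ≤ n
  /-- it is neither contractible nor isotopic to a boundary segment -/
  lt : a + 1 < b
  /-- it has no self-crossings -/
  simple : ∀ k : ℤ, ¬ Interlace (a, b) (translate n k (a, b))

/-- The pair `p` is a lift of the arc `α`. -/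
def Arc.IsLift {n : ℕ} (α : Arc n) (p : ℤ × ℤ) : Prop := ∃ k : ℤ, p = translate n k (α.a, α.b)

/-- Two arcs are compatible if they have representatives that do not meet outside the marked
points, that is, if no lift of one crosses a lift of the other. -/
def Arc.Compatible {n : ℕ} (α β : Arc n) : Prop :=
  ∀ p q : ℤ × ℤ, α.IsLift p → β.IsLift q → ¬ Interlace p q

/-- A pending arc: a loop around the orbifold point. -/
def Arc.IsPending {n : ℕ} (α : Arc n) : Prop := α.b = α.a + (n + 1)

/-- A triangulation of `Σ_n`: a maximal collection of pairwise compatible arcs. -/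
structure Triangulation (n : ℕ) where
  arcs : Set (Arc n)
  compatible : ∀ α ∈ arcs, ∀ β ∈ arcs, α.Compatible β
  maximal : ∀ γ : Arc n, (∀ α ∈ arcs, γ.Compatible α) → γ ∈ arcs

theorem Arc.b_le {n : ℕ} (α : Arc n) : α.b ≤ α.a + (n + 1) := by
  by_contra h
  refine α.simple 1 (Or.inl ⟨?_, ?_, ?_⟩) <;> simp only [translate] <;> omega

instance (n : ℕ) : Finite (Arc n) := by
  let f : Arc n → Set.Icc (0 : ℤ) n × Set.Icc (0 : ℤ) (2 * n + 1) := fun α =>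
    (⟨α.a, α.a_nonneg, α.a_le⟩, ⟨α.b, by have := α.a_nonneg; have := α.lt; omega,
      by have := α.a_le; have := α.b_le; omega⟩)
  refine Finite.of_injective f fun α β h => ?_
  simp only [f, Prod.mk.injEq] at h
  exact Arc.ext (congrArg Subtype.val h.1) (congrArg Subtype.val h.2)

namespace Triangulation

variable {n : ℕ} (τ : Triangulation n)

/-- The vertices of the quiver `Q(τ)` are the arcs of `τ`. -/
def Vertex : Type := {α : Arc n // α ∈ τ.arcs}

instance : Finite τ.Vertex := inferInstanceAs (Finite {α : Arc n // α ∈ τ.arcs})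

/-- A boundary segment or an arc of `τ`, given by (the endpoints of) a lift. -/
def IsSide (p : ℤ × ℤ) : Prop := p.2 = p.1 + 1 ∨ ∃ α ∈ τ.arcs, α.IsLift p

/-- A triangle of `τ`, given by the vertices `x < y < z` of its unique lift with `0 ≤ x ≤ n`.
If `z = x + n + 1` then the side from `x` to `z` is the pending arc, and this is the orbifold
triangle: the digon with vertices `v_x`, `v_y` that contains the pending arc at `v_x`.
Otherwise it is an ordinary triangle. -/
@[ext]
structure Triangle where
  x : ℤ
  y : ℤ
  z : ℤ
  x_nonneg : 0 ≤ x
  x_le : x ≤ n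
  x_lt : x < y
  y_lt : y < z
  side_xy : τ.IsSide (x, y)
  side_yz : τ.IsSide (y, z)
  side_xz : τ.IsSide (x, z)

/-- The sides of a triangle in clockwise order (`x`, `y`, `z` being in counterclockwise order). -/
def Triangle.side {τ : Triangulation n} (Δ : τ.Triangle) : Fin 3 → ℤ × ℤ :=
  ![(Δ.x, Δ.z), (Δ.y, Δ.z), (Δ.x, Δ.y)]

/-- The arrows of `Q(τ)`. -/
inductive Arrow : τ.Vertex → τ.Vertex → Type
  /-- In every triangle there is an arrow from `α` to `β` whenever the arcs `α`, `β` are sides of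
  the triangle and `β` succeeds `α` in the clockwise orientation. -/
  | inTriangle (Δ : τ.Triangle) (k : Fin 3) {α β : τ.Vertex}
      (hα : α.1.IsLift (Δ.side k)) (hβ : β.1.IsLift (Δ.side (k + 1))) : Arrow α β
  /-- There is a loop at the pending arc. -/
  | loop (α : τ.Vertex) (h : α.1.IsPending) : Arrow α α

/-- The quiver `Q(τ)`. -/
instance : Quiver τ.Vertex := ⟨τ.Arrow⟩

/-- An internal triangle: all of its sides are arcs of `τ`. -/
@[ext]
structure InternalTriangle extends τ.Triangle where
  arc : Fin 3 → τ.Vertex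
  isLift : ∀ k, (arc k).1.IsLift (toTriangle.side k)

/-- The arrow of an internal triangle from its `k`-th side to the next one. -/
def InternalTriangle.arrow {τ : Triangulation n} (Δ : τ.InternalTriangle) (k : Fin 3) :
    Δ.arc k ⟶ Δ.arc (k + 1) :=
  Arrow.inTriangle Δ.toTriangle k (Δ.isLift k) (Δ.isLift (k + 1))

/-- The 3-cycle of an internal triangle. -/
def InternalTriangle.cycle {τ : Triangulation n} (Δ : τ.InternalTriangle) : QPath τ.Vertex :=
  ⟨Δ.arc 0, Δ.arc 0, ((Path.nil.cons (Δ.arrow 0)).cons (Δ.arrow 1)).cons (Δ.arrow 2)⟩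

/-- The pending arcs of `τ` (in fact there is exactly one). -/
def PendingArc : Type := {α : τ.Vertex // α.1.IsPending}

/-- The loop `ε` at the pending arc. -/
def PendingArc.loop {τ : Triangulation n} (α : τ.PendingArc) : α.1 ⟶ α.1 := Arrow.loop α.1 α.2

/-- The path `ε³`. -/
def PendingArc.loopCubed {τ : Triangulation n} (α : τ.PendingArc) : QPath τ.Vertex :=
  ⟨α.1, α.1, ((Path.nil.cons α.loop).cons α.loop).cons α.loop⟩

instance : Finite τ.Triangle := by
  have hz : ∀ Δ : τ.Triangle, Δ.z ≤ Δ.x + (n + 1) := fun Δ => by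
    have h₁ := Δ.x_lt
    have h₂ := Δ.y_lt
    rcases Δ.side_xz with h | ⟨α, -, k, h⟩
    · dsimp only at h; omega
    · have := α.b_le
      simp only [translate, Prod.mk.injEq] at h
      omega
  let f : τ.Triangle →
      Set.Icc (0 : ℤ) n × Set.Icc (0 : ℤ) (2 * n + 1) × Set.Icc (0 : ℤ) (2 * n + 1) := fun Δ =>
    (⟨Δ.x, Δ.x_nonneg, Δ.x_le⟩,
      ⟨Δ.y, by have := Δ.x_nonneg; have := Δ.x_lt; omega,
        by have := Δ.x_le; have := Δ.y_lt; have := hz Δ; omega⟩,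
      ⟨Δ.z, by have := Δ.x_nonneg; have := Δ.x_lt; have := Δ.y_lt; omega,
        by have := Δ.x_le; have := hz Δ; omega⟩)
  refine Finite.of_injective f fun Δ Δ' h => ?_
  simp only [f, Prod.mk.injEq] at h
  exact Triangle.ext (congrArg Subtype.val h.1) (congrArg Subtype.val h.2.1)
    (congrArg Subtype.val h.2.2)

instance : Finite τ.InternalTriangle := by
  let f : τ.InternalTriangle → τ.Triangle × (Fin 3 → τ.Vertex) := fun Δ => (Δ.toTriangle, Δ.arc)
  refine Finite.of_injective f fun Δ Δ' h => ?_
  cases Δ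
  cases Δ'
  simp only [f, Prod.mk.injEq] at h
  obtain ⟨rfl, rfl⟩ := h
  rfl

instance : Finite τ.PendingArc := inferInstanceAs (Finite {α : τ.Vertex // α.1.IsPending})

noncomputable instance : Fintype τ.InternalTriangle := Fintype.ofFinite _

noncomputable instance : Fintype τ.PendingArc := Fintype.ofFinite _

/-- The potential `S(τ)`: the sum of the 3-cycles of the internal triangles plus `ε³`. -/
noncomputable def potential : CompletedPathAlgebra τ.Vertex :=
  ∑ Δ : τ.InternalTriangle, ofPath Δ.cycle + ∑ α : τ.PendingArc, ofPath α.loopCubed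

/-- The algebra `Λ(τ) = 𝒫(Q(τ), S(τ))`. -/
abbrev Lam : Type := JacobianAlgebra τ.potential

end Triangulation

end OrbPoly

/-! Every arc has two sides: in the half plane, a triangle lies below its longest side `(x, z)` and
above the other two. On each side an arc bounds at most one triangle. A pending arc has maximal
width, so no triangle lies above it, and its loop `ε` can be placed there. Label both ends of every
arrow by the side on which it leaves or arrives. At each vertex at most one arrow then leaves and at
most one arrives on each side (`Arrow.tailLabel_inj`, `Arrow.headLabel_inj`). Let `P` consist of the
paths `b a` such that `a` arrives on the side on which `b` leaves. Since there are only two labels,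
all conditions on numbers of arrows in the definition of a gentle algebra follow formally.

The paths in `P` are those formed by two consecutive arrows of one triangle, together with `ε²`.
Each completes to a cycle in the potential (`exists_cycle_of_relation`), and all length-two subpaths
of the cycles in the potential, read cyclically, lie in `P` (`potential_supportedOnTriangles`). By
uniqueness of arrows with given labels, a cyclic derivative involves at most one path. Its
coefficient is nonzero when this path completes to a cycle in the potential, because the
coefficients of the potential are natural numbers and cannot cancel; for `ε²` it is 3. So the cyclic
derivatives and `P` generate the same ideal.

A path containing no relation changes sides at every vertex and thus turns around a marked point. A
rank built from the widths of arcs increases along it (`Arrow.rank_lt_rank`), so its length is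
bounded. Hence `⟨P⟩` is admissible, and a high power of the arrow ideal lies in the closed Jacobian
ideal. Truncating series to finite sums then identifies the two quotients
(`Polarization.exists_algEquiv`). -/

namespace OrbPoly

open Quiver CompletedPathAlgebra

/-! ### Paths as lists of arrows -/

section Paths

variable {V : Type*} [Quiver V]

/-- The arrows of a path, the last one first. -/
def arrowList {i : V} : {j : V} → Path i j → List (Σ k l : V, k ⟶ l)
  | _, .nil => []
  | _, .cons p e => ⟨_, _, e⟩ :: arrowList p

theorem length_arrowList {i j : V} (p : Path i j) : (arrowList p).length = p.length := by
  induction p with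
  | nil => rfl
  | cons p e ih => simp [arrowList, ih]

theorem arrowList_comp {i j k : V} (p : Path i j) (q : Path j k) :
    arrowList (p.comp q) = arrowList q ++ arrowList p := by
  induction q with
  | nil => rfl
  | cons q e ih => simp [arrowList, ih]

theorem exists_eq_cons_cons {i j : V} (p : Path i j) (hp : p.length = 2) :
    ∃ (k : V) (a : i ⟶ k) (b : k ⟶ j), p = (Path.nil.cons a).cons b := by
  cases p with
  | nil => simp at hp
  | cons p b =>
    cases p with
    | nil => simp at hp
    | cons p a =>
      cases p with
      | nil => exact ⟨_, a, b, rfl⟩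
      | cons p c => simp at hp

theorem path₂_inj {i j k i' j' k' : V} {a : i ⟶ j} {b : j ⟶ k} {a' : i' ⟶ j'} {b' : j' ⟶ k'}
    (h : path₂ b a = path₂ b' a') :
    (⟨i, j, a⟩ : Σ k l : V, k ⟶ l) = ⟨i', j', a'⟩ ∧
      (⟨j, k, b⟩ : Σ k l : V, k ⟶ l) = ⟨j', k', b'⟩ := by
  have := congrArg (fun p : QPath V => arrowList p.2.2) h
  simp only [path₂, arrowList_comp, Hom.toPath, arrowList, 
    List.cons_append, List.nil_append, List.cons.injEq, and_true] at this
  exact this.symm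

theorem finite_paths_length_lt [Finite V] (hfin : ∀ i j : V, Finite (i ⟶ j)) (m : ℕ) :
    {p : QPath V | p.len < m}.Finite := by
  have hQ : Finite (Σ k l : V, k ⟶ l) := inferInstance
  have hl : {l : List (Σ k l : V, k ⟶ l) | l.length < m}.Finite := List.finite_length_lt _ m
  -- A path is determined by its starting vertex and its arrows; the vertex is needed only to tell
  -- trivial paths apart.
  refine Set.Finite.of_finite_image (f := fun p : QPath V => (p.1, arrowList p.2.2))
    ((Set.finite_univ.prod hl).subset ?_) ?_
  · rintro _ ⟨p, hp, rfl⟩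
    exact ⟨trivial, by simpa [length_arrowList, QPath.len] using hp⟩
  · rintro ⟨i, j, p⟩ - ⟨i', j', q⟩ - h
    simp only [Prod.mk.injEq] at h
    obtain ⟨rfl, h⟩ := h
    clear hl
    induction p generalizing j' with
    | nil =>
      cases q with
      | nil => rfl
      | cons q f => simp [arrowList] at h
    | cons p e ih =>
      cases q with
      | nil => simp [arrowList] at h
      | cons q f =>
        simp only [arrowList, List.cons.injEq] at h
        have h₁ := ih _ q h.2
        have h₂ := h.1
        cases h₁
        cases h₂
        rfl

end Paths

/-! ### Multiplication of paths and finite sums of paths -/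

section PathAlgebra

theorem smul_mem_twoSidedIdeal {A : Type*} [Ring A] [Algebra ℂ A] (I : TwoSidedIdeal A) (c : ℂ)
    {x : A} (hx : x ∈ I) : c • x ∈ I := by
  rw [Algebra.smul_def]
  exact I.mul_mem_left _ _ hx

variable {V : Type*} [Quiver V]

theorem ofPath_apply [DecidableEq (QPath V)] (p q : QPath V) :
    ofPath p q = if q = p then 1 else 0 := by
  unfold ofPath
  split_ifs <;> rfl

theorem ofPath_self (p : QPath V) : ofPath p p = 1 := by
  classical simp [ofPath_apply]

theorem ofPath_of_ne {p q : QPath V} (h : q ≠ p) : ofPath p q = 0 := by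
  classical simp [ofPath_apply, h]

/-- The length indicator brings the sum over all splittings of a path into the form of
`one_mul_aux`, which leaves only the splitting before the last arrow. -/
theorem ofPath_eq_ite_mul {i j k l m : V} (e : i ⟶ j) (r : Path k l) (e' : l ⟶ m) :
    ofPath ⟨i, j, e.toPath⟩ ⟨k, m, r.cons e'⟩ =
      (if r.length = 0 then 1 else 0) * ofPath ⟨i, j, e.toPath⟩ ⟨l, m, e'.toPath⟩ := by
  cases r with
  | nil => simp [Hom.toPath]
  | cons r d =>
    rw [ofPath_of_ne]
    · simp
    · intro h
      have := congrArg QPath.len h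
      simp [QPath.len] at this

theorem ofPath_toPath_mul {i j k : V} (p : Path i j) (e : j ⟶ k) :
    ofPath ⟨j, k, e.toPath⟩ * ofPath ⟨i, j, p⟩ = ofPath ⟨i, k, p.cons e⟩ := by
  ext ⟨i', k', q⟩
  rw [mul_apply]
  cases q with
  | nil =>
    rw [ofPath_of_ne (p := ⟨i, k, p.cons e⟩)]
    · simp only [splits, List.map_cons, List.map_nil, List.sum_cons, List.sum_nil, add_zero]
      rw [ofPath_of_ne, zero_mul]
      intro h
      have := congrArg QPath.len h
      simp [QPath.len] at this
    · intro h
      have := congrArg QPath.len h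
      simp [QPath.len] at this
  | @cons l _ q e' =>
    have h₀ : ofPath (⟨j, k, e.toPath⟩ : QPath V) ⟨k', k', Path.nil⟩ = 0 := by
      refine ofPath_of_ne fun h => ?_
      have := congrArg QPath.len h
      simp [QPath.len] at this
    have h₁ := one_mul_aux q fun l q => ofPath ⟨i, j, p⟩ ⟨i', l, q⟩
    simp only [splits, List.map_cons, List.map_map, Function.comp_def, List.sum_cons, h₀, zero_mul,
      zero_add, ofPath_eq_ite_mul, mul_assoc, mul_left_comm _ (ofPath _ _)]
    rw [List.sum_map_mul_left, h₁]
    classical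
    rw [ofPath_apply, ofPath_apply, ofPath_apply, mul_ite, mul_one, mul_zero, ← ite_and]
    refine if_congr ⟨fun h => ?_, fun h => ?_⟩ rfl rfl
    · obtain ⟨h, h'⟩ := h
      cases h
      cases h'
      rfl
    · cases h
      exact ⟨rfl, rfl⟩

theorem sum_smul_apply (s : Finset (QPath V)) (c : QPath V → ℂ) (q : QPath V) :
    (∑ p ∈ s, c p • ofPath p : CompletedPathAlgebra V) q =
      (by classical exact if q ∈ s then c q else 0) := by
  classical
  have : (∑ p ∈ s, c p • ofPath p : CompletedPathAlgebra V) q = ∑ p ∈ s, c p * ofPath p q :=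
    Finset.sum_apply (M := fun _ => ℂ) q s _
  rw [this]
  simp [ofPath_apply]

variable [Finite V]

theorem ofPath_mem (p : QPath V) : ofPath p ∈ PathAlgebra V := by
  refine (Set.finite_singleton p).subset fun q hq => ?_
  by_contra h
  exact hq (ofPath_of_ne h)

end PathAlgebra

/-! ### Gentle algebras from labelled arrow ends -/

/-- A labelling of the two ends of every arrow by `Bool` such that arrows with the same tail are
told apart by the labels at their tails, and arrows with the same head by the labels at their
heads. -/
structure Polarization (V : Type*) [Quiver V] where
  tail : ∀ {i j : V}, (i ⟶ j) → Bool
  head : ∀ {i j : V}, (i ⟶ j) → Bool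
  tail_inj : ∀ {i j k : V} (a : i ⟶ j) (b : i ⟶ k), tail a = tail b →
    (⟨j, a⟩ : Σ l : V, i ⟶ l) = ⟨k, b⟩
  head_inj : ∀ {i j k : V} (a : i ⟶ k) (b : j ⟶ k), head a = head b →
    (⟨i, a⟩ : Σ l : V, l ⟶ k) = ⟨j, b⟩

namespace Polarization

variable {V : Type*} [Quiver V] (π : Polarization V)

/-- The paths `b a` of length two whose labels at the middle vertex agree. -/
def relations : Set (QPath V) :=
  {p | ∃ (i j k : V) (a : i ⟶ j) (b : j ⟶ k), π.head a = π.tail b ∧ p = path₂ b a}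

/-- A path that has no subpath among the relations. -/
def Avoids {i j : V} (p : Path i j) : Prop :=
  (arrowList p).IsChain fun b a => π.head a.2.2 ≠ π.tail b.2.2

theorem path₂_mem_relations {i j k : V} (b : j ⟶ k) (a : i ⟶ j) :
    path₂ b a ∈ π.relations ↔ π.head a = π.tail b := by
  constructor
  · rintro ⟨i', j', k', a', b', h, h'⟩
    obtain ⟨h₁, h₂⟩ := path₂_inj h'
    cases h₁
    cases h₂
    exact h
  · exact fun h => ⟨_, _, _, a, b, h, rfl⟩

theorem avoids_of_comp {i j k : V} {p : Path i j} {q : Path j k} (h : π.Avoids (p.comp q)) :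
    π.Avoids p ∧ π.Avoids q := by
  unfold Avoids at *
  rw [arrowList_comp] at h
  exact ⟨h.right_of_append, h.left_of_append⟩

theorem finite_hom (π : Polarization V) (i j : V) : Finite (i ⟶ j) := by
  refine Finite.of_injective (fun a : i ⟶ j => π.tail a) fun a b h => ?_
  simpa using π.tail_inj a b h

theorem card_tail_le (π : Polarization V) (i : V) : ENat.card (Σ j : V, i ⟶ j) ≤ 2 := by
  have h : Function.Injective fun a : Σ j : V, i ⟶ j => π.tail a.2 := fun a b h =>
    π.tail_inj a.2 b.2 h
  simpa using ENat.card_le_card_of_injective h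

theorem card_head_le (π : Polarization V) (i : V) : ENat.card (Σ j : V, j ⟶ i) ≤ 2 := by
  have h : Function.Injective fun a : Σ j : V, j ⟶ i => π.head a.2 := fun a b h =>
    π.head_inj a.2 b.2 h
  simpa using ENat.card_le_card_of_injective h

theorem encard_before_le {i : V} (c : Bool) : {b : Σ k : V, k ⟶ i | π.head b.2 = c}.encard ≤ 1 :=
  Set.encard_le_one_iff.2 fun a b ha hb => π.head_inj a.2 b.2 (ha.trans hb.symm)

theorem encard_after_le {j : V} (c : Bool) : {b : Σ k : V, j ⟶ k | π.tail b.2 = c}.encard ≤ 1 :=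
  Set.encard_le_one_iff.2 fun a b ha hb => π.tail_inj a.2 b.2 (ha.trans hb.symm)

/-- The elements of the completed path algebra in which only paths that contain a relation
occur. -/
noncomputable def completedIdeal : TwoSidedIdeal (CompletedPathAlgebra V) :=
  TwoSidedIdeal.mk' {f | ∀ (i j : V) (p : Path i j), π.Avoids p → f ⟨i, j, p⟩ = 0}
    (fun _ _ _ _ => rfl)
    (fun hx hy i j p hp => by simp [hx i j p hp, hy i j p hp])
    (fun hx i j p hp => by simp [hx i j p hp])
    (fun {x y} hy i j p hp => by
      rw [mul_apply]
      refine List.sum_eq_zero fun c hc => ?_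
      obtain ⟨s, hs, rfl⟩ := List.mem_map.1 hc
      have hp' : π.Avoids (s.2.1.comp s.2.2) := by rwa [splits_comp p s hs]
      rw [hy _ _ s.2.1 (π.avoids_of_comp hp').1, mul_zero])
    (fun {x y} hx i j p hp => by
      rw [mul_apply]
      refine List.sum_eq_zero fun c hc => ?_
      obtain ⟨s, hs, rfl⟩ := List.mem_map.1 hc
      have hp' : π.Avoids (s.2.1.comp s.2.2) := by rwa [splits_comp p s hs]
      rw [hx _ _ s.2.2 (π.avoids_of_comp hp').2, zero_mul])

theorem mem_completedIdeal {f : CompletedPathAlgebra V} : f ∈ π.completedIdeal ↔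
    ∀ (i j : V) (p : Path i j), π.Avoids p → f ⟨i, j, p⟩ = 0 :=
  TwoSidedIdeal.mem_mk' ..

/-- Ranks increase strictly along a path avoiding the relations, so each arrow has rank at least the
number of arrows before it; as ranks are below `m`, there are at most `m` arrows. -/
theorem length_lt_of_rank (rank : ∀ {i j : V}, (i ⟶ j) → ℕ) (m : ℕ)
    (hm : ∀ {i j : V} (a : i ⟶ j), rank a < m)
    (hrank : ∀ {i j k : V} (a : i ⟶ j) (b : j ⟶ k), π.head a ≠ π.tail b → rank a < rank b)
    {i j : V} (p : Path i j) (hp : π.Avoids p) : p.length < m + 1 := by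
  have key : ∀ {i j k : V} (p : Path i j) (e : j ⟶ k), π.Avoids (p.cons e) →
      p.length ≤ rank e := by
    intro i j k p
    induction p generalizing k with
    | nil => simp
    | cons p d ih =>
      intro e h
      have h' := List.isChain_cons_cons.1 h
      have h₁ := ih d h'.2
      have h₂ := hrank d e h'.1
      rw [Path.length_cons]
      omega
  cases p with
  | nil => simp
  | cons p e =>
    have h₁ := key p e hp
    have h₂ := hm e
    rw [Path.length_cons]
    omega

variable [Finite V]

/-- Strip off final arrows as long as a relation remains. What is left ends in a relation, which
factors out on the left. -/
theorem ofPath_mem_pathIdeal {i j : V} (p : Path i j) (hp : ¬ π.Avoids p) :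
    (⟨ofPath ⟨i, j, p⟩, ofPath_mem _⟩ : PathAlgebra V) ∈ pathIdeal π.relations := by
  induction p with
  | nil => simp [Avoids, arrowList] at hp
  | cons p e ih =>
    by_cases h : π.Avoids p
    · cases p with
      | nil => simp [Avoids, arrowList] at hp
      | cons p d =>
        have hde : π.head d = π.tail e := by
          by_contra hne
          exact hp (List.isChain_cons_cons.2 ⟨hne, h⟩)
        have : (⟨ofPath ⟨_, _, (p.cons d).cons e⟩, ofPath_mem _⟩ : PathAlgebra V) =
            ⟨ofPath (path₂ e d), ofPath_mem _⟩ * ⟨ofPath ⟨_, _, p⟩, ofPath_mem _⟩ := by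
          refine Subtype.ext ?_
          have h₂ := ofPath_toPath_mul d.toPath e
          simp only [MulMemClass.mk_mul_mk]
          rw [← ofPath_toPath_mul, ← ofPath_toPath_mul, ← mul_assoc, h₂]
          rfl
        rw [this]
        exact TwoSidedIdeal.mul_mem_right _ _ _
          (TwoSidedIdeal.subset_span ⟨_, (π.path₂_mem_relations e d).2 hde, rfl⟩)
    · have : (⟨ofPath ⟨_, _, p.cons e⟩, ofPath_mem _⟩ : PathAlgebra V) =
          ⟨ofPath ⟨_, _, e.toPath⟩, ofPath_mem _⟩ * ⟨ofPath ⟨_, _, p⟩, ofPath_mem _⟩ :=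
        Subtype.ext (ofPath_toPath_mul p e).symm
      rw [this]
      exact TwoSidedIdeal.mul_mem_left _ _ _ (ih h)

/-- An element of the path algebra is a finite sum of paths, so the condition on its coefficients
can be used path by path. This replaces ideal membership by a test on the support. -/
theorem mem_pathIdeal (x : PathAlgebra V) :
    x ∈ pathIdeal π.relations ↔ (x : CompletedPathAlgebra V) ∈ π.completedIdeal := by
  constructor
  · intro hx
    have : pathIdeal π.relations ≤ π.completedIdeal.comap (PathAlgebra V).val := by
      refine TwoSidedIdeal.span_le.2 ?_
      rintro y ⟨p, ⟨i, j, k, a, b, hab, rfl⟩, hy⟩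
      rw [SetLike.mem_coe, TwoSidedIdeal.mem_comap]
      change (y : CompletedPathAlgebra V) ∈ _
      rw [hy, mem_completedIdeal]
      intro i' j' q hq
      refine ofPath_of_ne fun h => ?_
      cases h
      exact (List.isChain_cons_cons.1 hq).1 hab
    exact this hx
  · intro hx
    rw [mem_completedIdeal] at hx
    have hfin : {p : QPath V | (x : CompletedPathAlgebra V) p ≠ 0}.Finite := x.2
    have : x = ∑ p ∈ hfin.toFinset, (x : CompletedPathAlgebra V) p •
        (⟨ofPath p, ofPath_mem p⟩ : PathAlgebra V) := by
      refine Subtype.ext ?_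
      ext q
      rw [AddSubmonoidClass.coe_finsetSum]
      refine Eq.trans ?_ (sum_smul_apply hfin.toFinset x.1 q).symm
      split_ifs with h
      · rfl
      · simpa using h
    rw [this]
    refine sum_mem fun p hp => smul_mem_twoSidedIdeal _ _ ?_
    refine π.ofPath_mem_pathIdeal p.2.2 fun h => ?_
    simp only [Set.Finite.mem_toFinset, Set.mem_ofPred_eq] at hp
    exact hp (hx _ _ _ h)

/-- If the relations lie in an ideal whose elements only involve paths containing a relation, and
paths avoiding the relations are bounded in length, then the path algebra modulo the relations is
the completed path algebra modulo the closure of that ideal. -/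
theorem exists_algEquiv (I : TwoSidedIdeal (CompletedPathAlgebra V))
    (hI : I ≤ π.completedIdeal) (hrel : ∀ p ∈ π.relations, ofPath p ∈ I) (m : ℕ)
    (hm : ∀ {i j : V} (p : Path i j), π.Avoids p → p.length < m) :
    ∃ φ : (pathIdeal π.relations).ringCon.Quotient ≃ₐ[ℂ] (closure I).ringCon.Quotient,
      ∀ x : PathAlgebra V, φ ((pathIdeal π.relations).ringCon.mk' x) =
        (closure I).ringCon.mk' (x : CompletedPathAlgebra V) := by
  have hpath : pathIdeal π.relations ≤ I.comap (PathAlgebra V).val := by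
    refine TwoSidedIdeal.span_le.2 ?_
    rintro y ⟨p, hp, hy⟩
    rw [SetLike.mem_coe, TwoSidedIdeal.mem_comap]
    change (y : CompletedPathAlgebra V) ∈ _
    rw [hy]
    exact hrel p hp
  -- Paths of length at least `m` all contain a relation.
  have hpow : ∀ k, m ≤ k → arrowIdealPow V k ≤ π.completedIdeal := fun k hk f hf => by
    rw [mem_completedIdeal]
    intro i j p hp
    exact (TwoSidedIdeal.mem_mk' ..).1 hf ⟨i, j, p⟩ ((hm p hp).trans_le hk)
  have hcl : closure I ≤ π.completedIdeal :=
    (iInf_le _ m).trans (sup_le hI (hpow m le_rfl))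
  have hle : I ≤ closure I := le_iInf fun k => le_sup_left
  have htrunc : ∀ (f : CompletedPathAlgebra V) (k : ℕ), ∃ x : PathAlgebra V,
      ∀ p : QPath V, (x : CompletedPathAlgebra V) p =
        if p.len < k then f p else 0 := fun f k => by
    refine ⟨⟨fun p => if p.len < k then f p else 0,
      (finite_paths_length_lt π.finite_hom k).subset fun p hp => ?_⟩, fun p => rfl⟩
    by_contra h
    exact hp (if_neg h)
  have hsub : ∀ (f : CompletedPathAlgebra V) (k : ℕ) (x : PathAlgebra V),
      (∀ p : QPath V, (x : CompletedPathAlgebra V) p = if p.len < k then f p else 0) →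
      f - x ∈ arrowIdealPow V k := fun f k x hx => by
    refine (TwoSidedIdeal.mem_mk' ..).2 fun p hp => ?_
    rw [sub_eq_add_neg, CompletedPathAlgebra.add_apply, CompletedPathAlgebra.neg_apply, hx, if_pos hp, add_neg_cancel]
  -- Truncate `f` at length `k`: the finite part involves only paths of length at least `m`, so it
  -- lies in the ideal of the relations, and the rest lies in the `k`-th power of the arrow ideal.
  have hpowcl : arrowIdealPow V m ≤ closure I := fun f hf => by
    refine (TwoSidedIdeal.mem_iInf _).2 fun k => ?_
    obtain ⟨x, hx⟩ := htrunc f k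
    have hxI : x ∈ pathIdeal π.relations := by
      rw [mem_pathIdeal, mem_completedIdeal]
      intro i j p hp
      rw [hx, (TwoSidedIdeal.mem_mk' ..).1 hf ⟨i, j, p⟩ (hm p hp), ite_self]
    rw [← sub_add_cancel f x]
    exact TwoSidedIdeal.add_mem _ (TwoSidedIdeal.mem_sup_right (hsub f k x hx))
      (TwoSidedIdeal.mem_sup_left (hpath hxI))
  let g : PathAlgebra V →ₐ[ℂ] (closure I).ringCon.Quotient :=
    ((closure I).ringCon.mkₐ ℂ).comp (PathAlgebra V).val
  have hg : ∀ x y : PathAlgebra V, g x = g y ↔ (pathIdeal π.relations).ringCon x y := fun x y => by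
    rw [TwoSidedIdeal.rel_iff, mem_pathIdeal]
    refine ((closure I).ringCon.eq).trans ?_
    rw [TwoSidedIdeal.rel_iff]
    -- This gives injectivity: the closure only involves paths containing a relation, and a finite
    -- sum of such paths already lies in the ideal of the relations.
    refine ⟨fun h => hcl h, fun h => hle ?_⟩
    exact hpath ((π.mem_pathIdeal (x - y)).2 h)
  let φ := RingCon.liftₐ (pathIdeal π.relations).ringCon g fun x y h => (hg x y).2 h
  refine ⟨AlgEquiv.ofBijective φ ⟨?_, ?_⟩, fun x => rfl⟩
  · intro x y
    induction x using Quotient.inductionOn'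
    induction y using Quotient.inductionOn'
    intro h
    exact (RingCon.eq _).2 ((hg _ _).1 h)
  · intro y
    induction y using Quotient.inductionOn' with | h f =>
    -- Surjectivity: the tail of `f` from length `m` on vanishes in the quotient.
    obtain ⟨x, hx⟩ := htrunc f m
    refine ⟨(pathIdeal π.relations).ringCon.mk' x, ?_⟩
    refine (RingCon.eq _).2 ?_
    rw [TwoSidedIdeal.rel_iff, ← neg_sub]
    exact TwoSidedIdeal.neg_mem _ (hpowcl (hsub f m x hx))

theorem isGentle (m : ℕ) (hm : ∀ {i j : V} (p : Path i j), π.Avoids p → p.length < m) :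
    IsGentle π.relations where
  tail_le := π.card_tail_le
  head_le := π.card_head_le
  before_le i j a := by
    -- With two labels, not matching `π.tail a` means carrying the opposite label, which at most one
    -- incoming arrow does.
    simpa [path₂_mem_relations, Bool.eq_not] using π.encard_before_le (i := i) (!π.tail a)
  after_le i j a := by
    simpa [path₂_mem_relations, eq_comm, Bool.eq_not] using π.encard_after_le (j := j) (!π.head a)
  le_sq x hx p hp := by
    rw [mem_pathIdeal, mem_completedIdeal] at hx
    refine hx _ _ p.2.2 ?_
    unfold QPath.len at hp
    rw [← length_arrowList] at hp
    unfold Avoids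
    match arrowList p.2.2, hp with
    | [], _ => exact .nil
    | [_], _ => exact .singleton _
  pow_le := by
    refine ⟨m, fun x hx => ?_⟩
    rw [mem_pathIdeal, mem_completedIdeal]
    exact fun i j p hp => hx _ (hm p hp)
  len_eq := by
    rintro _ ⟨i, j, k, a, b, -, rfl⟩
    rfl
  before_mem_le i j a := by
    simpa [path₂_mem_relations] using π.encard_before_le (i := i) (π.tail a)
  after_mem_le i j a := by
    simpa [path₂_mem_relations, eq_comm] using π.encard_after_le (j := j) (π.head a)

end Polarization

end OrbPoly

/-! ### Cyclic derivatives of potentials made of 3-cycles -/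

namespace OrbPoly

open Quiver CompletedPathAlgebra

section CyclicDerivative

variable {V : Type*} [Quiver V]

theorem cyclicDerivative_apply {i j : V} (a : i ⟶ j) (S : CompletedPathAlgebra V) (p : Path j i) :
    cyclicDerivative a S ⟨j, i, p⟩ =
      ((splits p).map fun s => S ⟨_, _, (s.2.2.cons a).comp s.2.1⟩).sum := by
  unfold cyclicDerivative
  exact dif_pos ⟨rfl, rfl⟩

theorem exists_split_of_cyclicDerivative_ne_zero {i j : V} {a : i ⟶ j}
    {S : CompletedPathAlgebra V} {p : QPath V} (h : cyclicDerivative a S p ≠ 0) :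
    ∃ (k : V) (u : Path j k) (v : Path k i), p = ⟨j, i, u.comp v⟩ ∧
      S ⟨k, k, (v.cons a).comp u⟩ ≠ 0 := by
  by_cases hp : p.1 = j ∧ p.2.1 = i
  · obtain ⟨j', i', p⟩ := p
    obtain ⟨rfl, rfl⟩ := hp
    dsimp only at a h
    rw [cyclicDerivative_apply] at h
    obtain ⟨c, hc, hc0⟩ := List.exists_mem_ne_zero_of_sum_ne_zero h
    obtain ⟨s, hs, rfl⟩ := List.mem_map.1 hc
    exact ⟨s.1, s.2.1, s.2.2, by rw [splits_comp p s hs], hc0⟩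
  · unfold cyclicDerivative at h
    exact absurd (dif_neg hp) h

namespace Polarization

variable (π : Polarization V) {S : CompletedPathAlgebra V}

/-- Only 3-cycles all of whose cyclic subpaths of length two are relations occur in `S`. -/
def SupportedOnTriangles (S : CompletedPathAlgebra V) : Prop :=
  ∀ q : QPath V, S q ≠ 0 → ∃ a b c : Σ k l : V, k ⟶ l, arrowList q.2.2 = [c, b, a] ∧
    π.head a.2.2 = π.tail b.2.2 ∧ π.head b.2.2 = π.tail c.2.2 ∧ π.head c.2.2 = π.tail a.2.2

/-- Removing `c` from a 3-cycle leaves two arrows, and the labels match at all three corners. The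
match at the corner from `c` to `a` later determines `a`, and the next one determines `b`. -/
theorem eq_cons_cons_of_cyclicDerivative_ne_zero {i j : V} {c : i ⟶ j} {p : QPath V}
    (hcycle : π.SupportedOnTriangles S)
    (h : cyclicDerivative c S p ≠ 0) :
    ∃ (k : V) (a : j ⟶ k) (b : k ⟶ i), p = path₂ b a ∧
      π.head c = π.tail a ∧ π.head a = π.tail b := by
  obtain ⟨k, u, v, rfl, hS⟩ := exists_split_of_cyclicDerivative_ne_zero h
  obtain ⟨x, y, z, hq, hxy, hyz, hzx⟩ := hcycle _ hS
  rw [arrowList_comp, arrowList] at hq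
  have hlen : (u.comp v).length = 2 := by
    have := congrArg List.length hq
    simp only [List.length_append, List.length_cons, length_arrowList, List.length_nil] at this
    rw [Path.length_comp]
    omega
  obtain ⟨l, a, b, hab⟩ := exists_eq_cons_cons _ hlen
  refine ⟨l, a, b, by rw [hab]; rfl, ?_⟩
  have huv : arrowList v ++ arrowList u = [⟨_, _, b⟩, ⟨_, _, a⟩] := by
    rw [← arrowList_comp, hab]
    rfl
  generalize arrowList u = lu at hq huv
  generalize arrowList v = lv at hq huv
  -- The length of `u` tells whether `c` is the third, second or first arrow of the cycle in `S`.
  match lu, hq with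
  | [], hq =>
    simp only [List.nil_append, List.cons.injEq, List.append_nil] at hq huv
    obtain ⟨rfl, rfl⟩ := hq
    simp only [List.cons.injEq, and_true] at huv
    obtain ⟨rfl, rfl⟩ := huv
    exact ⟨hzx, hxy⟩
  | [_], hq =>
    simp only [List.cons_append, List.nil_append, List.cons.injEq] at hq
    obtain ⟨rfl, rfl, rfl⟩ := hq
    simp only [List.cons_append, List.nil_append, List.cons.injEq, and_true] at huv
    obtain ⟨rfl, rfl⟩ := huv
    exact ⟨hyz, hzx⟩
  | [_, _], hq =>
    simp only [List.cons_append, List.nil_append, List.cons.injEq] at hq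
    obtain ⟨rfl, rfl, rfl, rfl⟩ := hq
    simp only [List.nil_append, List.cons.injEq, and_true] at huv
    obtain ⟨rfl, rfl⟩ := huv
    exact ⟨hxy, hyz⟩
  | _ :: _ :: _ :: _, hq => simp at hq

theorem span_cyclicDerivative_le (hcycle : π.SupportedOnTriangles S) :
    TwoSidedIdeal.span {f | ∃ (i j : V) (a : i ⟶ j), f = cyclicDerivative a S} ≤
      π.completedIdeal := by
  refine TwoSidedIdeal.span_le.2 ?_
  rintro _ ⟨i, j, c, rfl⟩
  rw [SetLike.mem_coe, mem_completedIdeal]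
  intro i' j' p hp
  by_contra h
  obtain ⟨k, a, b, hab, -, h'⟩ := π.eq_cons_cons_of_cyclicDerivative_ne_zero hcycle h
  cases hab
  exact (List.isChain_cons_cons.1 hp).1 h'

/-- The arrow `c` completing the relation to a cycle has a derivative supported on this single path,
so the path is a scalar multiple of `cyclicDerivative c S`. -/
theorem ofPath_mem_span_cyclicDerivative
    (hcycle : π.SupportedOnTriangles S)
    (hnat : ∀ q : QPath V, ∃ m : ℕ, S q = m)
    (hex : ∀ {i j k : V} (a : i ⟶ j) (b : j ⟶ k), π.head a = π.tail b → ∃ c : k ⟶ i,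
      S ⟨i, i, ((Path.nil.cons a).cons b).cons c⟩ ≠ 0 ∨
      S ⟨j, j, ((Path.nil.cons b).cons c).cons a⟩ ≠ 0 ∨
      S ⟨k, k, ((Path.nil.cons c).cons a).cons b⟩ ≠ 0)
    (p : QPath V) (hp : p ∈ π.relations) :
    ofPath p ∈
      TwoSidedIdeal.span {f | ∃ (i j : V) (a : i ⟶ j), f = cyclicDerivative a S} := by
  obtain ⟨i, j, k, a, b, hab, rfl⟩ := hp
  obtain ⟨c, hc⟩ := hex a b hab
  have hne : cyclicDerivative c S (path₂ b a) ≠ 0 := by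
    change cyclicDerivative c S ⟨_, _, (Path.nil.cons a).cons b⟩ ≠ 0
    rw [cyclicDerivative_apply]
    -- The coefficient is the sum of the coefficients of the three rotations of the cycle. These are
    -- natural numbers, not all zero, so they cannot cancel.
    obtain ⟨x, hx⟩ := hnat ⟨i, i, ((Path.nil.cons a).cons b).cons c⟩
    obtain ⟨y, hy⟩ := hnat ⟨j, j, ((Path.nil.cons b).cons c).cons a⟩
    obtain ⟨z, hz⟩ := hnat ⟨k, k, ((Path.nil.cons c).cons a).cons b⟩
    simp only [splits, List.map_cons, List.map_nil, List.sum_cons, List.sum_nil,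
      Path.comp_cons, Path.comp_nil, hx, hy, hz] at hc ⊢
    norm_cast at hc ⊢
    omega
  have hca : π.head c = π.tail a := by
    obtain ⟨l, a', b', h, h', -⟩ := π.eq_cons_cons_of_cyclicDerivative_ne_zero hcycle hne
    obtain ⟨h₁, -⟩ := path₂_inj h
    cases h₁
    exact h'
  have heq : ofPath (path₂ b a) =
      (cyclicDerivative c S (path₂ b a))⁻¹ • cyclicDerivative c S := by
    ext q
    rw [CompletedPathAlgebra.smul_apply]
    by_cases hq : q = path₂ b a
    · rw [hq, ofPath_self, inv_mul_cancel₀ hne]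
    · rw [ofPath_of_ne hq]
      by_contra h
      have h := right_ne_zero_of_mul (Ne.symm h)
      obtain ⟨l, a', b', rfl, ha, hb⟩ := π.eq_cons_cons_of_cyclicDerivative_ne_zero hcycle h
      -- The labels at the corners force any path in the support to be `b a`.
      have h₁ := π.tail_inj a a' (hca.symm.trans ha)
      cases h₁
      have h₂ := π.tail_inj b b' (hab.symm.trans hb)
      cases h₂
      exact hq rfl
  rw [heq]
  exact smul_mem_twoSidedIdeal _ _ (TwoSidedIdeal.subset_span ⟨_, _, c, rfl⟩)

end Polarization

end CyclicDerivative

end OrbPoly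

/-! ### Arcs and triangles in the universal cover -/

namespace OrbPoly

open Quiver CompletedPathAlgebra

theorem Arc.IsLift.width {n : ℕ} {α : Arc n} {p : ℤ × ℤ} (h : α.IsLift p) :
    p.2 - p.1 = α.b - α.a := by
  obtain ⟨k, rfl⟩ := h
  simp [translate]

/-- The integers from `0` to `n` form a fundamental domain for the deck transformations. -/
theorem eq_of_add_mul_eq {n : ℕ} {x x' k : ℤ} (hx : 0 ≤ x) (hxn : x ≤ n) (hx' : 0 ≤ x')
    (hxn' : x' ≤ n) (h : x' = x + k * (n + 1)) : k = 0 := by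
  by_contra hk
  rcases lt_or_gt_of_ne hk with hk | hk
  · nlinarith
  · nlinarith

theorem Arc.IsLift.unique {n : ℕ} {α β : Arc n} {p : ℤ × ℤ} (hα : α.IsLift p)
    (hβ : β.IsLift p) : α = β := by
  obtain ⟨k, rfl⟩ := hα
  obtain ⟨l, h⟩ := hβ
  simp only [translate, Prod.mk.injEq] at h
  have h₀ := eq_of_add_mul_eq (k := k - l) α.a_nonneg α.a_le β.a_nonneg β.a_le
    (by linarith [h.1])
  obtain rfl : k = l := by omega
  exact Arc.ext (by linarith [h.1]) (by linarith [h.2])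

theorem Arc.IsLift.translate {n : ℕ} {α : Arc n} {p : ℤ × ℤ} (h : α.IsLift p) (k : ℤ) :
    α.IsLift (translate n k p) := by
  obtain ⟨l, rfl⟩ := h
  refine ⟨l + k, ?_⟩
  simp only [OrbPoly.translate, Prod.mk.injEq]
  constructor <;> ring

namespace Triangulation

variable {n : ℕ} {τ : Triangulation n}

theorem IsSide.translate {p : ℤ × ℤ} (h : τ.IsSide p) (k : ℤ) :
    τ.IsSide (translate n k p) := by
  rcases h with h | ⟨α, hα, h⟩
  · exact Or.inl (by simp only [OrbPoly.translate, h]; ring)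
  · exact Or.inr ⟨α, hα, h.translate k⟩

/-- No integer lies strictly between the ends of a boundary segment; for two arcs this is
compatibility. -/
theorem IsSide.not_interlace {p q : ℤ × ℤ} (hp : τ.IsSide p) (hq : τ.IsSide q) :
    ¬ Interlace p q := by
  rcases hp with hp | ⟨α, hα, hp⟩
  · unfold Interlace; omega
  rcases hq with hq | ⟨β, hβ, hq⟩
  · unfold Interlace; omega
  exact τ.compatible α hα β hβ p q hp hq

theorem IsSide.le {p : ℤ × ℤ} (hp : τ.IsSide p) : p.2 ≤ p.1 + (n + 1) := by
  rcases hp with hp | ⟨α, -, hp⟩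
  · omega
  · have := hp.width
    have := α.b_le
    omega

/-- A triangle given by the vertices of any of its lifts. -/
def IsTriangle (τ : Triangulation n) (x y z : ℤ) : Prop :=
  x < y ∧ y < z ∧ τ.IsSide (x, y) ∧ τ.IsSide (y, z) ∧ τ.IsSide (x, z)

/-- If `y < y'`, the sides `(x, y')` and `(y, z)` would cross. The next two lemmas rest on similar
crossings. -/
theorem IsTriangle.eq_below {x y y' z : ℤ} (h : τ.IsTriangle x y z) (h' : τ.IsTriangle x y' z) :
    y = y' := by
  obtain ⟨h₁, h₂, hxy, hyz, -⟩ := h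
  obtain ⟨h₁', h₂', hxy', hyz', -⟩ := h'
  have := hxy.not_interlace hyz'
  have := hxy'.not_interlace hyz
  simp only [Interlace] at *
  omega

theorem IsTriangle.eq_left {x x' y z : ℤ} (h : τ.IsTriangle x y z) (h' : τ.IsTriangle x' y z) :
    x = x' := by
  obtain ⟨h₁, h₂, hxy, -, hxz⟩ := h
  obtain ⟨h₁', h₂', hxy', -, hxz'⟩ := h'
  have := hxy.not_interlace hxz'
  have := hxy'.not_interlace hxz
  simp only [Interlace] at *
  omega

theorem IsTriangle.eq_right {x y z z' : ℤ} (h : τ.IsTriangle x y z) (h' : τ.IsTriangle x y z') :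
    z = z' := by
  obtain ⟨h₁, h₂, -, hyz, hxz⟩ := h
  obtain ⟨h₁', h₂', -, hyz', hxz'⟩ := h'
  have := hyz.not_interlace hxz'
  have := hyz'.not_interlace hxz
  simp only [Interlace] at *
  omega

/-- The long sides `(w, y)` and `(x, z)` would cross, so two triangles above `(x, y)` cannot lean to
opposite sides. -/
theorem IsTriangle.not_left_right {w x y z : ℤ} (h : τ.IsTriangle w x y) :
    ¬ τ.IsTriangle x y z := by
  intro h'
  obtain ⟨h₁, h₂, -, -, hwy⟩ := h
  obtain ⟨h₁', h₂', -, -, hxz⟩ := h'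
  have := hwy.not_interlace hxz
  simp only [Interlace] at *
  omega

theorem Triangle.isTriangle (Δ : τ.Triangle) (k : ℤ) :
    τ.IsTriangle (Δ.x + k * (n + 1)) (Δ.y + k * (n + 1)) (Δ.z + k * (n + 1)) :=
  ⟨by linarith [Δ.x_lt], by linarith [Δ.y_lt], Δ.side_xy.translate k, Δ.side_yz.translate k,
    Δ.side_xz.translate k⟩

theorem Triangle.eq_of_translate {Δ Δ' : τ.Triangle} {k l : ℤ}
    (hx : Δ.x + k * (n + 1) = Δ'.x + l * (n + 1)) (hy : Δ.y + k * (n + 1) = Δ'.y + l * (n + 1))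
    (hz : Δ.z + k * (n + 1) = Δ'.z + l * (n + 1)) : Δ = Δ' := by
  have h₀ := eq_of_add_mul_eq (k := k - l) Δ.x_nonneg Δ.x_le Δ'.x_nonneg Δ'.x_le (by linarith)
  obtain rfl : k = l := by omega
  exact Triangle.ext (by linarith) (by linarith) (by linarith)

theorem exists_translate_side {α : Arc n} {x y : ℤ} (h : α.IsLift (x, y)) :
    ∃ k : ℤ, x + k * (n + 1) = α.a ∧ y + k * (n + 1) = α.b := by
  obtain ⟨k, h⟩ := h
  simp only [translate, Prod.mk.injEq] at h
  exact ⟨-k, by linarith [h.1], by linarith [h.2]⟩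

/-- On each of its two sides an arc bounds at most one triangle; the triangle lies below it
exactly if the arc is its side with index `0`. -/
theorem Triangle.unique {α : Arc n} {Δ Δ' : τ.Triangle} {k k' : Fin 3} (h : α.IsLift (Δ.side k))
    (h' : α.IsLift (Δ'.side k')) (hk : k = 0 ↔ k' = 0) : Δ = Δ' ∧ k = k' := by
  match k, k', hk with
  | 0, 0, _ =>
    obtain ⟨m, ha, hb⟩ := exists_translate_side (x := Δ.x) (y := Δ.z) h
    obtain ⟨m', ha', hb'⟩ := exists_translate_side (x := Δ'.x) (y := Δ'.z) h'
    have t := Δ.isTriangle m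
    have t' := Δ'.isTriangle m'
    rw [ha, hb] at t
    rw [ha', hb'] at t'
    exact ⟨Triangle.eq_of_translate (ha.trans ha'.symm) (t.eq_below t') (hb.trans hb'.symm), rfl⟩
  | 1, 1, _ =>
    obtain ⟨m, ha, hb⟩ := exists_translate_side (x := Δ.y) (y := Δ.z) h
    obtain ⟨m', ha', hb'⟩ := exists_translate_side (x := Δ'.y) (y := Δ'.z) h'
    have t := Δ.isTriangle m
    have t' := Δ'.isTriangle m'
    rw [ha, hb] at t
    rw [ha', hb'] at t'
    exact ⟨Triangle.eq_of_translate (t.eq_left t') (ha.trans ha'.symm) (hb.trans hb'.symm), rfl⟩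
  | 2, 2, _ =>
    obtain ⟨m, ha, hb⟩ := exists_translate_side (x := Δ.x) (y := Δ.y) h
    obtain ⟨m', ha', hb'⟩ := exists_translate_side (x := Δ'.x) (y := Δ'.y) h'
    have t := Δ.isTriangle m
    have t' := Δ'.isTriangle m'
    rw [ha, hb] at t
    rw [ha', hb'] at t'
    exact ⟨Triangle.eq_of_translate (ha.trans ha'.symm) (hb.trans hb'.symm) (t.eq_right t'), rfl⟩
  | 1, 2, _ =>
    obtain ⟨m, ha, hb⟩ := exists_translate_side (x := Δ.y) (y := Δ.z) h
    obtain ⟨m', ha', hb'⟩ := exists_translate_side (x := Δ'.x) (y := Δ'.y) h'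
    have t := Δ.isTriangle m
    have t' := Δ'.isTriangle m'
    rw [ha, hb] at t
    rw [ha', hb'] at t'
    exact absurd t' t.not_left_right
  | 2, 1, _ =>
    obtain ⟨m, ha, hb⟩ := exists_translate_side (x := Δ.x) (y := Δ.y) h
    obtain ⟨m', ha', hb'⟩ := exists_translate_side (x := Δ'.y) (y := Δ'.z) h'
    have t := Δ.isTriangle m
    have t' := Δ'.isTriangle m'
    rw [ha, hb] at t
    rw [ha', hb'] at t'
    exact absurd t t'.not_left_right
  | 0, 1, hk => simp at hk
  | 0, 2, hk => simp at hk
  | 1, 0, hk => simp at hk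
  | 2, 0, hk => simp at hk

/-- The width `n + 1` is maximal among sides, whereas sides `1` and `2` are strictly narrower than
side `0`. So the space above a pending arc is free for the loop. -/
theorem Triangle.eq_zero_of_isPending {α : Arc n} (hα : α.IsPending) {Δ : τ.Triangle} {k : Fin 3}
    (h : α.IsLift (Δ.side k)) : k = 0 := by
  have hw := h.width
  have hle := Δ.side_xz.le
  have h₁ := Δ.x_lt
  have h₂ := Δ.y_lt
  unfold Arc.IsPending at hα
  match k with
  | 0 => rfl
  | 1 =>
    change Δ.z - Δ.y = _ at hw
    dsimp only at hle
    omega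
  | 2 =>
    change Δ.y - Δ.x = _ at hw
    dsimp only at hle
    omega

/-! ### The labelling of the arrows of `Q(τ)` -/

/-- The side of its tail on which an arrow leaves: `false` below the arc, `true` above it, where
the side above the pending arc is the one of the orbifold point. -/
def Arrow.tailLabel : {α β : τ.Vertex} → τ.Arrow α β → Bool
  | _, _, .inTriangle _ k _ _ => decide (k ≠ 0)
  | _, _, .loop _ _ => true

/-- The side of its head on which an arrow arrives. -/
def Arrow.headLabel : {α β : τ.Vertex} → τ.Arrow α β → Bool
  | _, _, .inTriangle _ k _ _ => decide (k + 1 ≠ 0)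
  | _, _, .loop _ _ => true

/-- The label fixes the triangle and the position of `α` in it by `Triangle.unique`, hence the next
side; a loop cannot share its label with an arrow of a triangle. -/
theorem Arrow.tailLabel_inj {α β γ : τ.Vertex} (a : τ.Arrow α β) (b : τ.Arrow α γ)
    (h : a.tailLabel = b.tailLabel) : (⟨β, a⟩ : Σ δ : τ.Vertex, τ.Arrow α δ) = ⟨γ, b⟩ := by
  cases a with
  | inTriangle Δ k hα hβ =>
    cases b with
    | inTriangle Δ' k' hα' hγ =>
      simp only [tailLabel, decide_eq_decide, not_iff_not, ne_eq] at h
      obtain ⟨rfl, rfl⟩ := Triangle.unique hα hα' h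
      obtain rfl : β = γ := Subtype.ext (hβ.unique hγ)
      rfl
    | loop _ hp =>
      have := Triangle.eq_zero_of_isPending hp hα
      simp [tailLabel, this] at h
  | loop _ hp =>
    cases b with
    | inTriangle Δ' k' hα' hγ =>
      have := Triangle.eq_zero_of_isPending hp hα'
      simp [tailLabel, this] at h
    | loop => rfl

theorem Arrow.headLabel_inj {α β γ : τ.Vertex} (a : τ.Arrow α γ) (b : τ.Arrow β γ)
    (h : a.headLabel = b.headLabel) : (⟨α, a⟩ : Σ δ : τ.Vertex, τ.Arrow δ γ) = ⟨β, b⟩ := by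
  cases a with
  | inTriangle Δ k hα hγ =>
    cases b with
    | inTriangle Δ' k' hβ hγ' =>
      simp only [headLabel, decide_eq_decide, not_iff_not, ne_eq] at h
      obtain ⟨rfl, hk⟩ := Triangle.unique hγ hγ' h
      obtain rfl : k = k' := add_right_cancel hk
      obtain rfl : α = β := Subtype.ext (hα.unique hβ)
      rfl
    | loop _ hp =>
      have := Triangle.eq_zero_of_isPending hp hγ
      simp [headLabel, this] at h
  | loop _ hp =>
    cases b with
    | inTriangle Δ' k' hβ hγ =>
      have := Triangle.eq_zero_of_isPending hp hγ
      simp [headLabel, this] at h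
    | loop => rfl

/-- The arrows of `Q(τ)` labelled by the sides on which they leave and arrive. -/
def polarization (τ : Triangulation n) : Polarization τ.Vertex where
  tail a := Arrow.tailLabel a
  head a := Arrow.headLabel a
  tail_inj a b h := Arrow.tailLabel_inj a b h
  head_inj a b h := Arrow.headLabel_inj a b h

/-! ### Bounding the length of paths without relations -/

/-- A path avoiding the relations rotates around a marked point; it first visits wider and wider
arcs, arriving from below, and then narrower and narrower ones, arriving from above. -/
def Arrow.rank {α β : τ.Vertex} (a : τ.Arrow α β) : ℕ :=
  if a.headLabel then 2 * (n + 1) + 1 - (β.1.b - β.1.a).toNat else (β.1.b - β.1.a).toNat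

theorem Arrow.rank_lt {α β : τ.Vertex} (a : τ.Arrow α β) : a.rank < 2 * (n + 1) + 1 := by
  have h₁ := β.1.b_le
  have h₂ := β.1.lt
  unfold rank
  split_ifs <;> omega

theorem Arrow.rank_lt_rank {α β γ : τ.Vertex} (a : τ.Arrow α β) (b : τ.Arrow β γ)
    (h : a.headLabel ≠ b.tailLabel) : a.rank < b.rank := by
  have hβ₁ := β.1.b_le
  have hβ₂ := β.1.lt
  have hγ₁ := γ.1.b_le
  have hγ₂ := γ.1.lt
  unfold rank
  cases ha : a.headLabel with
  | false =>
    cases hb : b.headLabel with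
    | false =>
      simp only [Bool.false_eq_true, if_false]
      cases b with
      | loop => simp [headLabel] at hb
      | inTriangle Δ k hβ hγ =>
        -- Arriving from below means passing from side `(x, y)` to the wider side `(x, z)`.
        obtain rfl : k = 2 := by
          simp only [headLabel, ne_eq, decide_eq_false_iff_not, not_not] at hb
          exact (by decide : ∀ k : Fin 3, k + 1 = 0 → k = 2) k hb
        have w₁ : Δ.y - Δ.x = _ := hβ.width
        have w₂ : Δ.z - Δ.x = _ := hγ.width
        have := Δ.y_lt
        omega
    | true =>
      -- The turning point, possibly the loop: widths are at most `n + 1`, so ranks of arrows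
      -- arriving from below are at most `n + 1` and those of arrows arriving from above at least `n
      -- + 2`.
      simp only [Bool.false_eq_true, if_false, if_true]
      omega
  | true =>
    cases b with
    | loop => simp [ha, tailLabel] at h
    | inTriangle Δ k hβ hγ =>
      -- After arriving from above the path leaves below, from `(x, z)` to the narrower side `(y,
      -- z)`, where it again arrives from above.
      obtain rfl : k = 0 := by
        simpa [ha, tailLabel] using h
      have w₁ : Δ.z - Δ.x = _ := hβ.width
      have w₂ : Δ.z - Δ.y = _ := hγ.width
      have := Δ.x_lt
      have hb : (inTriangle Δ 0 hβ hγ).headLabel = true := by simp [headLabel]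
      simp only [hb, if_true]
      omega

/-! ### The potential and its 3-cycles -/

theorem potential_apply (q : QPath τ.Vertex) : τ.potential q =
    ∑ Δ : τ.InternalTriangle, ofPath Δ.cycle q + ∑ α : τ.PendingArc, ofPath α.loopCubed q :=
  congrArg₂ (· + ·) (Finset.sum_apply (M := fun _ => ℂ) q _ _)
    (Finset.sum_apply (M := fun _ => ℂ) q _ _)

theorem potential_apply_eq_natCast (q : QPath τ.Vertex) : ∃ m : ℕ, τ.potential q = m := by
  classical
  simp only [potential_apply, ofPath_apply]
  exact ⟨∑ Δ : τ.InternalTriangle, (if q = Δ.cycle then 1 else 0) +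
    ∑ α : τ.PendingArc, (if q = α.loopCubed then 1 else 0), by push_cast; rfl⟩

theorem potential_cycle_ne_zero (Δ : τ.InternalTriangle) : τ.potential Δ.cycle ≠ 0 := by
  classical
  simp only [potential_apply, ofPath_apply, Finset.sum_boole]
  norm_cast
  refine (Nat.add_pos_left (Finset.card_pos.2 ⟨Δ, ?_⟩) _).ne'
  simp

theorem potential_loopCubed_ne_zero (α : τ.PendingArc) : τ.potential α.loopCubed ≠ 0 := by
  classical
  simp only [potential_apply, ofPath_apply, Finset.sum_boole]
  norm_cast
  refine (Nat.add_pos_right _ (Finset.card_pos.2 ⟨α, ?_⟩)).ne'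
  simp

theorem eq_of_potential_ne_zero {q : QPath τ.Vertex} (h : τ.potential q ≠ 0) :
    (∃ Δ : τ.InternalTriangle, q = Δ.cycle) ∨ ∃ α : τ.PendingArc, q = α.loopCubed := by
  by_contra! hcon
  refine h ?_
  rw [potential_apply, Finset.sum_eq_zero fun Δ _ => ofPath_of_ne (hcon.1 Δ),
    Finset.sum_eq_zero fun α _ => ofPath_of_ne (hcon.2 α), add_zero]

/-- Consecutive arrows of a triangle meet on the side of the common arc facing that triangle, and
both ends of `ε` lie above the pending arc. -/
theorem potential_supportedOnTriangles :
    τ.polarization.SupportedOnTriangles τ.potential := by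
  intro q hq
  rcases eq_of_potential_ne_zero hq with ⟨Δ, rfl⟩ | ⟨α, rfl⟩
  · exact ⟨⟨_, _, Δ.arrow 0⟩, ⟨_, _, Δ.arrow 1⟩, ⟨_, _, Δ.arrow 2⟩, rfl, rfl, rfl, rfl⟩
  · exact ⟨⟨_, _, α.loop⟩, ⟨_, _, α.loop⟩, ⟨_, _, α.loop⟩, rfl, rfl, rfl, rfl⟩

theorem potential_triangle_ne_zero (Δ : τ.Triangle) {α β γ : τ.Vertex}
    (hα : α.1.IsLift (Δ.side 0)) (hβ : β.1.IsLift (Δ.side 1)) (hγ : γ.1.IsLift (Δ.side 2)) :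
    τ.potential ⟨α, α, ((Path.nil.cons
      (show α ⟶ β from Arrow.inTriangle Δ 0 hα hβ)).cons
      (show β ⟶ γ from Arrow.inTriangle Δ 1 hβ hγ)).cons
      (show γ ⟶ α from Arrow.inTriangle Δ 2 hγ hα)⟩ ≠ 0 :=
  potential_cycle_ne_zero ⟨Δ, ![α, β, γ], fun k => match k with
    | 0 => hα
    | 1 => hβ
    | 2 => hγ⟩

/-- Two arrows meeting on the same side of `β` belong to the same triangle, whose three sides are
then all arcs, or are both the loop. -/
theorem exists_cycle_of_relation {α β γ : τ.Vertex} (a : τ.Arrow α β) (b : τ.Arrow β γ)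
    (h : a.headLabel = b.tailLabel) : ∃ c : γ ⟶ α,
      τ.potential ⟨α, α, ((Path.nil.cons a).cons b).cons c⟩ ≠ 0 ∨
      τ.potential ⟨β, β, ((Path.nil.cons b).cons c).cons a⟩ ≠ 0 ∨
      τ.potential ⟨γ, γ, ((Path.nil.cons c).cons a).cons b⟩ ≠ 0 := by
  cases a with
  | inTriangle Δ k hα hβ =>
    cases b with
    | inTriangle Δ' k' hβ' hγ =>
      simp only [Arrow.headLabel, Arrow.tailLabel, decide_eq_decide, not_iff_not, ne_eq] at h
      obtain ⟨rfl, rfl⟩ := Triangle.unique hβ hβ' h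
      -- The potential contains only the rotation starting at side `0`, so `k` decides which
      -- alternative holds.
      match k with
      | 0 => exact ⟨Arrow.inTriangle Δ 2 hγ hα, Or.inl (potential_triangle_ne_zero Δ hα hβ hγ)⟩
      | 1 =>
        exact ⟨Arrow.inTriangle Δ 0 hγ hα, Or.inr (Or.inr (potential_triangle_ne_zero Δ hγ hα hβ))⟩
      | 2 =>
        exact ⟨Arrow.inTriangle Δ 1 hγ hα, Or.inr (Or.inl (potential_triangle_ne_zero Δ hβ hγ hα))⟩
    | loop _ hp =>
      have := Triangle.eq_zero_of_isPending hp hβ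
      simp [Arrow.headLabel, Arrow.tailLabel, this] at h
  | loop _ hp =>
    cases b with
    | inTriangle Δ' k' hβ' hγ =>
      have := Triangle.eq_zero_of_isPending hp hβ'
      simp [Arrow.headLabel, Arrow.tailLabel, this] at h
    | loop _ _ => exact ⟨Arrow.loop _ hp, Or.inl (potential_loopCubed_ne_zero ⟨α, hp⟩)⟩

theorem length_lt_of_avoids {α β : τ.Vertex} (p : Path α β) (hp : τ.polarization.Avoids p) :
    p.length < 2 * (n + 1) + 1 + 1 :=
  τ.polarization.length_lt_of_rank (fun a => Arrow.rank a) _ (fun a => Arrow.rank_lt a)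
    (fun a b h => Arrow.rank_lt_rank a b h) p hp

end Triangulation

end OrbPoly

theorem mainTheorem10 (n : ℕ) (hn : 2 ≤ n) (τ : OrbPoly.Triangulation n) :
    ∃ P : Set (OrbPoly.QPath τ.Vertex), OrbPoly.IsGentle P ∧
      ∃ φ : (OrbPoly.pathIdeal P).ringCon.Quotient ≃ₐ[ℂ] τ.Lam,
        ∀ x : OrbPoly.PathAlgebra τ.Vertex,
          φ ((OrbPoly.pathIdeal P).ringCon.mk' x) =
            (OrbPoly.CompletedPathAlgebra.jacobianIdeal τ.potential).ringCon.mk'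
              (x : OrbPoly.CompletedPathAlgebra τ.Vertex) := by
  refine ⟨τ.polarization.relations, τ.polarization.isGentle _ fun p hp =>
    OrbPoly.Triangulation.length_lt_of_avoids p hp, ?_⟩
  exact τ.polarization.exists_algEquiv _
    (τ.polarization.span_cyclicDerivative_le OrbPoly.Triangulation.potential_supportedOnTriangles)
    (τ.polarization.ofPath_mem_span_cyclicDerivative
      OrbPoly.Triangulation.potential_supportedOnTriangles
      OrbPoly.Triangulation.potential_apply_eq_natCast
      fun a b h => OrbPoly.Triangulation.exists_cycle_of_relation a b h) _
    fun p hp => OrbPoly.Triangulation.length_lt_of_avoids p hp
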